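/- Let $\mathcal S$ and $\mathcal A$ be finite sets, $\mathcal A\neq\emptyset$, let $c:\mathcal S\times\mathcal A\to\mathbb R$, let $\alpha\in(0,1)$, and let $f:\mathcal S\times\mathcal A\times[0,1]\to\mathcal S$ be measurable. Consider the discounted-cost Markov decision problem with dynamics $S_{t+1}=f(S_t,A_t,W_t)$, $t\ge 0$, where the $W_t$ are i.i.d. uniform on $[0,1]$, and let $$v^\star(s)=\min_{\gamma:\mathcal S\to\mathcal A}\ \sum_{k=0}^{\infty}\alpha^k\,\mathbb E\big[c(S_k,\gamma(S_k))\,\big|\,S_0=s,\ A_t=\gamma(S_t)\ \text{for all } t\big]$$ be its optimal value function. Let $\mathcal V=\{v\in\mathbb R^{\mathcal S}:\max_s|v(s)|\le\|c\|_\infty/(1-\alpha)\}$, with the supremum norm. For every $n\ge 1$ let $(Z^n_{k,i})_{k\ge 0,\,1\le i\le n}$ be i.i.d. random variables, uniform on $[0,1]$, all defined on one probability space (the joint law for different values of $n$ is arbitrary). Define the empirical Bellman operators $$\hat T^n_k v(s)=\min_{a\in\mathcal A}\Big(c(s,a)+\frac{\alpha}{n}\sum_{i=1}^n v\big(f(s,a,Z^n_{k,i})\big)\Big)$$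 and the iterates $\hat v^n_0=0$, $\hat v^n_{k+1}=\hat T^n_k\hat v^n_k$. Then $v^\star$ satisfies the Bellman equation $v^\star(s)=\min_{a\in\mathcal A}\big(c(s,a)+\alpha\,\mathbb E[v^\star(f(s,a,W))]\big)$ for all $s\in\mathcal S$, where $W$ is uniform on $[0,1]$. Moreover, there are $\mathcal V$-valued random variables $\hat v^n_\infty$, $n\ge1$, on the same probability space such that, for every fixed $n\ge 1$, $\hat v^n_k$ converges in distribution to $\hat v^n_\infty$ as $k\to\infty$, and $\hat v^n_\infty$ converges in probability to $v^\star$ as $n\to\infty$. -/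

import Mathlib

open MeasureTheory ProbabilityTheory Filter Topology

/-- A discounted-cost Markov decision problem with state space `S` and action space `A`, in noise
form: `S_{t+1} = next S_t A_t W_t` with `W_t` uniform on `[0,1]`, stage cost `cost s a` and discount
factor `discount ∈ (0,1)`. The spaces `S`, `A` are finite and discrete wherever this is used, so
measurability of `next` on `S × A × [0,1]` is measurability of every section `next s a`. -/
structure DiscountedMDP (S A : Type*) [MeasurableSpace S] where
  next : S → A → unitInterval → S
  measurable_next : ∀ s a, Measurable (next s a)
  cost : S → A → ℝ
  discount : ℝ
  discount_pos : 0 < discount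
  discount_lt_one : discount < 1

namespace DiscountedMDP

variable {S A : Type*} [MeasurableSpace S] (M : DiscountedMDP S A)

/-- The state at time `k` under the stationary strategy `γ`, from the state `s` at time `0`, when
the noise sequence is `w`. -/
def state (γ : S → A) (s : S) (w : ℕ → unitInterval) : ℕ → S
  | 0 => s
  | k + 1 => M.next (state γ s w k) (γ (state γ s w k)) (w k)

/-- The infinite-horizon discounted cost `∑_{k ≥ 0} α^k E[c(S_k, γ(S_k))]` of the stationary
strategy `γ` from the initial state `s`; the noise is i.i.d. uniform on `[0,1]`. -/
noncomputable def discountedCost (γ : S → A) (s : S) : ℝ :=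
  ∑' k : ℕ, M.discount ^ k *
    ∫ w, M.cost (M.state γ s w k) (γ (M.state γ s w k))
      ∂(Measure.infinitePi fun _ : ℕ => (volume : Measure unitInterval))

/-- The optimal value function: the least discounted cost over the stationary strategies. -/
noncomputable def optimalValue (s : S) : ℝ :=
  ⨅ γ : S → A, M.discountedCost γ s

/-- The Bellman operator `(T v)(s) = min_a (c(s,a) + α E[v(f(s,a,W))])`, `W` uniform on `[0,1]`. -/
noncomputable def bellman [Fintype A] [Nonempty A] (v : S → ℝ) (s : S) : ℝ :=
  Finset.univ.inf' Finset.univ_nonempty fun a : A =>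
    M.cost s a + M.discount * ∫ w : unitInterval, v (M.next s a w)

/-- The empirical Bellman operator of the samples `z_1, …, z_n`:
`v ↦ (s ↦ min_a (c(s,a) + (α/n) ∑_i v(f(s,a,z_i))))`. -/
noncomputable def empiricalBellman [Fintype A] [Nonempty A] {n : ℕ} (z : Fin n → unitInterval)
    (v : S → ℝ) (s : S) : ℝ :=
  Finset.univ.inf' Finset.univ_nonempty fun a : A =>
    M.cost s a + M.discount / n * ∑ i, v (M.next s a (z i))

/-- Empirical value iteration from `0`, using the samples `z k` at step `k`. -/
noncomputable def empiricalIterate [Fintype A] [Nonempty A] {n : ℕ}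
    (z : ℕ → Fin n → unitInterval) : ℕ → S → ℝ
  | 0 => 0
  | k + 1 => M.empiricalBellman (z k) (empiricalIterate z k)

/-- The space `{v : max_s |v(s)| ≤ ‖c‖_∞ / (1 - α)}` of value functions. -/
def valueSpace [Fintype S] [Fintype A] : Set (S → ℝ) :=
  {v | ∀ s, |v s| ≤ ‖M.cost‖ / (1 - M.discount)}

end DiscountedMDP

/-! The forward iterates keep fluctuating with each new sample, so the limit is built by reversing
time. The samples are i.i.d., hence `T₀ ∘ ⋯ ∘ T_{k-1}` applied to 0 has the law of the `k`-th
forward iterate (`identDistrib_backwardIterate`). A new sample now enters innermost and is damped by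
`α ^ k`, so the backward iterates converge for every outcome, and sure convergence gives convergence
in distribution of the forward ones. For consistency, let `v` be the Bellman fixed point. If the
first `k` empirical operators move `v` by at most `η`, the backward limit is within `O(α ^ k) + η /
(1 - α)` of `v` (`dist_backwardLimit_le`). With `k` fixed, this concerns finitely many sample
averages, and Chebyshev's inequality applies. Each `n` is estimated separately, so the coupling
between different `n` is irrelevant. The Bellman equation follows from Banach's theorem and policy
evaluation: the fixed point bounds every policy cost from below and is attained by a greedy policy.
-/

theorem Finset.abs_inf'_sub_inf'_le {ι : Type*} {s : Finset ι} (hs : s.Nonempty) {f g : ι → ℝ}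
    {r : ℝ} (h : ∀ i ∈ s, |f i - g i| ≤ r) : |s.inf' hs f - s.inf' hs g| ≤ r := by
  rw [abs_sub_le_iff]
  constructor
  · rw [sub_le_iff_le_add, ← sub_le_iff_le_add']
    refine Finset.le_inf' _ _ fun i hi => ?_
    have := (abs_sub_le_iff.1 (h i hi)).1
    have := Finset.inf'_le f hi
    linarith
  · rw [sub_le_iff_le_add, ← sub_le_iff_le_add']
    refine Finset.le_inf' _ _ fun i hi => ?_
    have := (abs_sub_le_iff.1 (h i hi)).2
    have := Finset.inf'_le g hi
    linarith

namespace DiscountedMDP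

variable {S A : Type*} [MeasurableSpace S] (M : DiscountedMDP S A)

theorem one_sub_discount_pos : 0 < 1 - M.discount := sub_pos.2 M.discount_lt_one

/-! ### Contraction estimates and the invariant ball. -/

section Bounds

variable [Fintype S]

theorem abs_cost_le [Fintype A] (s : S) (a : A) : |M.cost s a| ≤ ‖M.cost‖ :=
  (norm_le_pi_norm (M.cost s) a).trans (norm_le_pi_norm M.cost s)

theorem abs_average_sub_le {n : ℕ} (z : Fin n → unitInterval) (v w : S → ℝ) (s : S) (a : A) :
    |M.discount / n * ∑ i, v (M.next s a (z i)) - M.discount / n * ∑ i, w (M.next s a (z i))|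
      ≤ M.discount * ‖v - w‖ := by
  have hα := M.discount_pos
  rw [← mul_sub, ← Finset.sum_sub_distrib, abs_mul, abs_of_nonneg (by positivity)]
  -- For `n = 0` the sums are empty, so the left side vanishes.
  rcases Nat.eq_zero_or_pos n with rfl | hn
  · simp; positivity
  have : |∑ i, (v (M.next s a (z i)) - w (M.next s a (z i)))| ≤ n * ‖v - w‖ := by
    refine (Finset.abs_sum_le_sum_abs _ _).trans ?_
    refine (Finset.sum_le_card_nsmul _ _ ‖v - w‖ fun i _ => ?_).trans (by simp)
    exact norm_le_pi_norm (v - w) (M.next s a (z i))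
  have hn' : (0 : ℝ) < n := by exact_mod_cast hn
  calc _ ≤ M.discount / n * (n * ‖v - w‖) := by gcongr
    _ = _ := by field_simp

theorem mem_valueSpace_iff [Fintype A] (v : S → ℝ) :
    v ∈ M.valueSpace ↔ ‖v‖ ≤ ‖M.cost‖ / (1 - M.discount) := by
  rw [pi_norm_le_iff_of_nonneg (div_nonneg (norm_nonneg _) M.one_sub_discount_pos.le)]
  rfl

theorem isClosed_valueSpace [Fintype A] : IsClosed M.valueSpace := by
  have : M.valueSpace = {v | ‖v‖ ≤ ‖M.cost‖ / (1 - M.discount)} :=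
    Set.ext M.mem_valueSpace_iff
  rw [this]
  exact isClosed_le continuous_norm continuous_const

theorem abs_integral_next_sub_le [DiscreteMeasurableSpace S] (v w : S → ℝ) (s : S) (a : A) :
    |(∫ u, v (M.next s a u)) - ∫ u, w (M.next s a u)| ≤ ‖v - w‖ := by
  have hint (v : S → ℝ) : Integrable (fun u => v (M.next s a u)) :=
    .of_bound ((measurable_of_finite v).comp (M.measurable_next s a)).aestronglyMeasurable ‖v‖
      (.of_forall fun u => norm_le_pi_norm v _)
  rw [← integral_sub (hint v) (hint w)]
  have h := norm_integral_le_of_norm_le_const (μ := (volume : Measure unitInterval))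
    (.of_forall fun u => norm_le_pi_norm (v - w) (M.next s a u))
  rwa [probReal_univ, mul_one] at h

variable [Fintype A] [Nonempty A]

theorem dist_empiricalBellman_le {n : ℕ} (z : Fin n → unitInterval) (v w : S → ℝ) :
    dist (M.empiricalBellman z v) (M.empiricalBellman z w) ≤ M.discount * dist v w := by
  have hα := M.discount_pos
  rw [dist_pi_le_iff (by positivity)]
  intro s
  rw [Real.dist_eq, dist_eq_norm]
  refine Finset.abs_inf'_sub_inf'_le _ fun a _ => ?_
  rw [add_sub_add_left_eq_sub]
  exact M.abs_average_sub_le z v w s a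

theorem norm_empiricalBellman_zero_le {n : ℕ} (z : Fin n → unitInterval) :
    ‖M.empiricalBellman z 0‖ ≤ ‖M.cost‖ := by
  refine (pi_norm_le_iff_of_nonneg (norm_nonneg _)).2 fun s => ?_
  have := Finset.abs_inf'_sub_inf'_le (Finset.univ_nonempty (α := A)) (f := M.cost s) (g := 0)
    (r := ‖M.cost‖) (by simpa using M.abs_cost_le s)
  have h0 : Finset.univ.inf' (Finset.univ_nonempty (α := A)) (0 : A → ℝ) = 0 :=
    Finset.inf'_const _ _
  rw [h0, sub_zero] at this
  simpa [empiricalBellman] using this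

/-- The radius `R = ‖c‖ / (1 - α)` solves `‖c‖ + α R = R`. -/
theorem empiricalBellman_mem_valueSpace {n : ℕ} (z : Fin n → unitInterval) {v : S → ℝ}
    (hv : v ∈ M.valueSpace) : M.empiricalBellman z v ∈ M.valueSpace := by
  rw [mem_valueSpace_iff] at *
  have h1 := M.dist_empiricalBellman_le z v 0
  have h2 := M.norm_empiricalBellman_zero_le z
  have h3 := norm_le_norm_add_norm_sub' (M.empiricalBellman z v) (M.empiricalBellman z 0)
  rw [dist_zero_right, dist_eq_norm] at h1
  have h4 := mul_le_mul_of_nonneg_left hv M.discount_pos.le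
  have h5 : ‖M.cost‖ + M.discount * (‖M.cost‖ / (1 - M.discount))
      = ‖M.cost‖ / (1 - M.discount) := by
    have := M.one_sub_discount_pos.ne'
    field_simp
    ring
  linarith

theorem empiricalIterate_mem_valueSpace {n : ℕ} (z : ℕ → Fin n → unitInterval) (k : ℕ) :
    M.empiricalIterate z k ∈ M.valueSpace := by
  induction k with
  | zero =>
    rw [mem_valueSpace_iff, empiricalIterate, norm_zero]
    exact div_nonneg (norm_nonneg _) M.one_sub_discount_pos.le
  | succ k ih => exact M.empiricalBellman_mem_valueSpace _ ih

theorem dist_bellman_le [DiscreteMeasurableSpace S] (v w : S → ℝ) :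
    dist (M.bellman v) (M.bellman w) ≤ M.discount * dist v w := by
  have hα := M.discount_pos
  rw [dist_pi_le_iff (by positivity)]
  intro s
  rw [Real.dist_eq, dist_eq_norm]
  refine Finset.abs_inf'_sub_inf'_le _ fun a _ => ?_
  rw [add_sub_add_left_eq_sub, ← mul_sub, abs_mul, abs_of_pos hα]
  exact mul_le_mul_of_nonneg_left (M.abs_integral_next_sub_le v w s a) hα.le

theorem exists_bellman_eq [DiscreteMeasurableSpace S] : ∃ v : S → ℝ, M.bellman v = v := by
  have h : ContractingWith ⟨M.discount, M.discount_pos.le⟩ (M.bellman : (S → ℝ) → S → ℝ) :=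
    ⟨M.discount_lt_one, LipschitzWith.of_dist_le_mul M.dist_bellman_le⟩
  exact ⟨h.fixedPoint, h.fixedPoint_isFixedPt⟩

end Bounds

/-! ### Policy evaluation and the Bellman equation. -/

section Policy

theorem state_congr (γ : S → A) (s : S) {w w' : ℕ → unitInterval} {k : ℕ}
    (h : ∀ j < k, w j = w' j) : M.state γ s w k = M.state γ s w' k := by
  induction k with
  | zero => rfl
  | succ k ih => rw [state, state, ih fun j hj => h j (hj.trans k.lt_succ_self), h k k.lt_succ_self]

theorem abs_integral_state_le [Fintype S] (γ : S → A) (s : S) (k : ℕ) (g : S → ℝ) :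
    |∫ w, g (M.state γ s w k)
      ∂(Measure.infinitePi fun _ : ℕ => (volume : Measure unitInterval))| ≤ ‖g‖ :=
  (norm_integral_le_of_norm_le_const (.of_forall fun _ => norm_le_pi_norm g _)).trans (by simp)

theorem hasSum_discountedCost [Fintype S] (γ : S → A) (s : S) :
    HasSum (fun k : ℕ => M.discount ^ k *
      ∫ w, M.cost (M.state γ s w k) (γ (M.state γ s w k))
        ∂(Measure.infinitePi fun _ : ℕ => (volume : Measure unitInterval)))
      (M.discountedCost γ s) := by
  refine Summable.hasSum <| .of_norm_bounded
    (g := fun k => M.discount ^ k * ‖fun x => M.cost x (γ x)‖)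
    ((summable_geometric_of_lt_one M.discount_pos.le M.discount_lt_one).mul_right _) fun k => ?_
  rw [norm_mul, Real.norm_of_nonneg (pow_nonneg M.discount_pos.le k)]
  exact mul_le_mul_of_nonneg_left (M.abs_integral_state_le γ s k fun x => M.cost x (γ x))
    (pow_nonneg M.discount_pos.le k)

theorem tendsto_sum_cost_add_terminal [Fintype S] (γ : S → A) (s : S) (v : S → ℝ) :
    Tendsto (fun N => (∑ k ∈ Finset.range N, M.discount ^ k *
      ∫ w, M.cost (M.state γ s w k) (γ (M.state γ s w k))
        ∂(Measure.infinitePi fun _ : ℕ => (volume : Measure unitInterval))) +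
      M.discount ^ N * (∫ w, v (M.state γ s w N)
        ∂(Measure.infinitePi fun _ : ℕ => (volume : Measure unitInterval))))
      atTop (𝓝 (M.discountedCost γ s)) := by
  rw [← add_zero (M.discountedCost γ s)]
  refine (M.hasSum_discountedCost γ s).tendsto_sum_nat.add ?_
  refine squeeze_zero_norm (a := fun N => M.discount ^ N * ‖v‖) (fun N => ?_) ?_
  · rw [norm_mul, Real.norm_of_nonneg (pow_nonneg M.discount_pos.le N)]
    exact mul_le_mul_of_nonneg_left (M.abs_integral_state_le γ s N v)
      (pow_nonneg M.discount_pos.le N)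
  · simpa using (tendsto_pow_atTop_nhds_zero_of_lt_one M.discount_pos.le
      M.discount_lt_one).mul_const ‖v‖

variable [Fintype S] [DiscreteMeasurableSpace S]

theorem measurable_next_prod (γ : S → A) :
    Measurable fun p : S × unitInterval => M.next p.1 (γ p.1) p.2 :=
  measurable_from_prod_countable_right fun x => M.measurable_next x (γ x)

theorem measurable_state (γ : S → A) (s : S) (k : ℕ) :
    Measurable fun w => M.state γ s w k := by
  induction k with
  | zero => exact measurable_const
  | succ k ih => exact (M.measurable_next_prod γ).comp (ih.prodMk (measurable_pi_apply k))

/-- The state at time `k` is a function of the noise coordinates below `k` only. -/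
theorem indepFun_state (γ : S → A) (s : S) (k : ℕ) :
    IndepFun (fun w => M.state γ s w k) (fun w => w k)
      (Measure.infinitePi fun _ : ℕ => (volume : Measure unitInterval)) := by
  have h : iIndepFun (fun (i : ℕ) (w : ℕ → unitInterval) => w i)
      (Measure.infinitePi fun _ : ℕ => (volume : Measure unitInterval)) :=
    iIndepFun_infinitePi (X := fun _ => id) fun _ => measurable_id
  have h' := h.indepFun_finset (Finset.range k) {k} (by simp) fun i => measurable_pi_apply i
  -- The filler value 0 is harmless: by `state_congr` it never reaches the state at time `k`.
  let ext : (Finset.range k → unitInterval) → ℕ → unitInterval :=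
    fun x j => if hj : j ∈ Finset.range k then x ⟨j, hj⟩ else 0
  have hext : Measurable ext := by
    refine measurable_pi_lambda _ fun j => ?_
    by_cases hj : j ∈ Finset.range k
    · simpa only [ext, hj, dite_true] using measurable_pi_apply _
    · simpa only [ext, hj, dite_false] using measurable_const
  have := h'.comp ((M.measurable_state γ s k).comp hext)
    (measurable_pi_apply (⟨k, Finset.mem_singleton_self k⟩ : ({k} : Finset ℕ)))
  refine IndepFun.congr this (.of_forall fun w => ?_) (.of_forall fun w => rfl)
  refine M.state_congr γ s fun j hj => ?_
  simp [ext, hj]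

theorem integrable_state (γ : S → A) (s : S) (k : ℕ) (g : S → ℝ) :
    Integrable (fun w => g (M.state γ s w k))
      (Measure.infinitePi fun _ : ℕ => (volume : Measure unitInterval)) :=
  .of_bound ((measurable_of_finite g).comp (M.measurable_state γ s k)).aestronglyMeasurable ‖g‖
    (.of_forall fun _ => norm_le_pi_norm g _)

/-- The Markov property in expectation: independence makes the joint law of state and noise a
product, and Fubini integrates out the noise. -/
theorem integral_state_succ (γ : S → A) (s : S) (k : ℕ) (g : S → ℝ) :
    ∫ w, g (M.state γ s w (k + 1))
        ∂(Measure.infinitePi fun _ : ℕ => (volume : Measure unitInterval)) =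
      ∫ w, (fun x => ∫ u, g (M.next x (γ x) u)) (M.state γ s w k)
        ∂(Measure.infinitePi fun _ : ℕ => (volume : Measure unitInterval)) := by
  set μ := Measure.infinitePi fun _ : ℕ => (volume : Measure unitInterval)
  have hm := M.measurable_state γ s k
  have hg : Measurable fun p : S × unitInterval => g (M.next p.1 (γ p.1) p.2) :=
    (measurable_of_finite g).comp (M.measurable_next_prod γ)
  have hlaw := (indepFun_iff_map_prod_eq_prod_map_map hm.aemeasurable
    (measurable_pi_apply k).aemeasurable).1 (M.indepFun_state γ s k)
  rw [Measure.infinitePi_map_eval] at hlaw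
  have : IsProbabilityMeasure (μ.map fun w => M.state γ s w k) :=
    Measure.isProbabilityMeasure_map hm.aemeasurable
  calc _ = ∫ p, g (M.next p.1 (γ p.1) p.2) ∂(μ.map fun w => (M.state γ s w k, w k)) := by
        rw [integral_map (hm.prodMk (measurable_pi_apply k)).aemeasurable
          hg.aestronglyMeasurable]
        rfl
    _ = ∫ x, (∫ u, g (M.next x (γ x) u)) ∂(μ.map fun w => M.state γ s w k) := by
        rw [hlaw, integral_prod]
        exact .of_bound hg.aestronglyMeasurable ‖g‖ (.of_forall fun _ => norm_le_pi_norm g _)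
    _ = _ := integral_map hm.aemeasurable (measurable_of_finite _).aestronglyMeasurable

/-- The partial sums of the cost of `γ`, corrected by a terminal value `v`, accumulate the
expected one-step Bellman residuals of `v`. -/
theorem sum_cost_add_terminal (γ : S → A) (s : S) (v : S → ℝ) (N : ℕ) :
    (∑ k ∈ Finset.range N, M.discount ^ k *
      ∫ w, M.cost (M.state γ s w k) (γ (M.state γ s w k))
        ∂(Measure.infinitePi fun _ : ℕ => (volume : Measure unitInterval))) +
      M.discount ^ N * (∫ w, v (M.state γ s w N)
        ∂(Measure.infinitePi fun _ : ℕ => (volume : Measure unitInterval))) =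
    v s + ∑ k ∈ Finset.range N, M.discount ^ k *
      ∫ w, (fun x => M.cost x (γ x) + M.discount * (∫ u, v (M.next x (γ x) u)) - v x)
        (M.state γ s w k) ∂(Measure.infinitePi fun _ : ℕ => (volume : Measure unitInterval)) := by
  induction N with
  | zero => simp [state]
  | succ N ih =>
    have h1 := M.integrable_state γ s N fun x => M.cost x (γ x)
    have h2 := M.integrable_state γ s N fun x => ∫ u, v (M.next x (γ x) u)
    have h3 := M.integrable_state γ s N v
    rw [Finset.sum_range_succ, Finset.sum_range_succ, M.integral_state_succ]
    beta_reduce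
    have h4 := integral_sub (h1.add (h2.const_mul M.discount)) h3
    simp only [Pi.add_apply] at h4
    rw [h4, integral_add h1 (h2.const_mul _), integral_const_mul, pow_succ]
    linear_combination ih

theorem le_discountedCost (γ : S → A) (s : S) {v : S → ℝ}
    (h : ∀ x, v x ≤ M.cost x (γ x) + M.discount * ∫ u, v (M.next x (γ x) u)) :
    v s ≤ M.discountedCost γ s := by
  refine ge_of_tendsto' (M.tendsto_sum_cost_add_terminal γ s v) fun N => ?_
  rw [sum_cost_add_terminal]
  refine le_add_of_nonneg_right (Finset.sum_nonneg fun k _ => ?_)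
  exact mul_nonneg (pow_nonneg M.discount_pos.le k)
    (integral_nonneg fun w => sub_nonneg.2 (h _))

theorem discountedCost_eq (γ : S → A) (s : S) {v : S → ℝ}
    (h : ∀ x, v x = M.cost x (γ x) + M.discount * ∫ u, v (M.next x (γ x) u)) :
    M.discountedCost γ s = v s := by
  refine tendsto_nhds_unique (M.tendsto_sum_cost_add_terminal γ s v) ?_
  simp_rw [sum_cost_add_terminal, ← h]
  simp

theorem optimalValue_eq_of_bellman_eq [Fintype A] [Nonempty A] {v : S → ℝ}
    (hv : M.bellman v = v) : M.optimalValue = v := by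
  have hle (γ : S → A) (s : S) : v s ≤ M.discountedCost γ s := by
    refine M.le_discountedCost γ s fun x => ?_
    conv_lhs => rw [← hv]
    exact Finset.inf'_le (fun a => M.cost x a + M.discount * ∫ u, v (M.next x a u))
      (Finset.mem_univ (γ x))
  -- A greedy policy for `v` has zero Bellman residual, so its cost is exactly `v`.
  choose γ _ hγ using fun x => Finset.exists_mem_eq_inf' (Finset.univ_nonempty (α := A))
    fun a => M.cost x a + M.discount * ∫ u, v (M.next x a u)
  ext s
  have hs : M.discountedCost γ s = v s :=
    M.discountedCost_eq γ s fun x => by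
      conv_lhs => rw [← hv]
      exact hγ x
  refine le_antisymm ?_ (le_ciInf fun γ => hle γ s)
  rw [← hs]
  exact ciInf_le ⟨v s, Set.forall_mem_range.2 fun γ => hle γ s⟩ γ

theorem bellman_optimalValue [Fintype A] [Nonempty A] :
    M.bellman M.optimalValue = M.optimalValue := by
  obtain ⟨v, hv⟩ := M.exists_bellman_eq
  rw [M.optimalValue_eq_of_bellman_eq hv, hv]

end Policy

end DiscountedMDP

/-! ### Chebyshev's bound for sample averages. -/

/-- A quantitative weak law of large numbers for bounded functions of i.i.d. variables. -/
theorem measure_le_abs_average_sub_integral_le {Ω E : Type*} [MeasurableSpace Ω]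
    [MeasurableSpace E] {P : Measure Ω} [IsProbabilityMeasure P] {μ : Measure E} {n : ℕ}
    (hn : 0 < n) {Z : Fin n → Ω → E} (hZ : ∀ i, Measurable (Z i)) (hμ : ∀ i, P.map (Z i) = μ)
    (hind : iIndepFun Z P) {g : E → ℝ} (hg : Measurable g) {C : ℝ} (hC : ∀ x, |g x| ≤ C)
    {η : ℝ} (hη : 0 < η) :
    P {ω | η ≤ |(∑ i, g (Z i ω)) / n - ∫ x, g x ∂μ|} ≤ ENNReal.ofReal (C ^ 2 / η ^ 2 / n) := by
  have hn' : (0 : ℝ) < n := Nat.cast_pos.2 hn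
  have hm (i : Fin n) : Measurable fun ω => g (Z i ω) := hg.comp (hZ i)
  have hL (i : Fin n) : MemLp (fun ω => g (Z i ω)) 2 P :=
    .of_bound (hm i).aestronglyMeasurable C (.of_forall fun ω => hC _)
  have hmean : P[fun ω => ∑ i, g (Z i ω)] = n * ∫ x, g x ∂μ := by
    rw [integral_finsetSum _ fun i _ => (hL i).integrable one_le_two]
    have (i : Fin n) : ∫ ω, g (Z i ω) ∂P = ∫ x, g x ∂μ := by
      rw [← hμ i, integral_map (hZ i).aemeasurable hg.aestronglyMeasurable]
    simp [this]
  have hvar : Var[fun ω => ∑ i, g (Z i ω); P] ≤ n * C ^ 2 := by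
    have h1 : (fun ω => ∑ i, g (Z i ω)) = ∑ i, fun ω => g (Z i ω) := by
      ext ω; simp
    rw [h1, IndepFun.variance_sum (fun i _ => hL i)
      fun i _ j _ hij => (hind.indepFun hij).comp hg hg]
    refine (Finset.sum_le_card_nsmul _ _ (C ^ 2) fun i _ => ?_).trans (by simp)
    refine (variance_le_sq_of_bounded (a := -C) (b := C)
      (.of_forall fun ω => abs_le.1 (hC _)) (hm i).aemeasurable).trans_eq (by ring)
  have hset : {ω | η ≤ |(∑ i, g (Z i ω)) / n - ∫ x, g x ∂μ|} =
      {ω | n * η ≤ |(∑ i, g (Z i ω)) - P[fun ω => ∑ i, g (Z i ω)]|} := by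
    ext ω
    have : (∑ i, g (Z i ω)) - n * ∫ x, g x ∂μ = n * ((∑ i, g (Z i ω)) / n - ∫ x, g x ∂μ) := by
      field_simp
    rw [Set.mem_ofPred_eq, Set.mem_ofPred_eq, hmean, this, abs_mul, abs_of_pos hn',
      mul_le_mul_iff_right₀ hn']
  rw [hset]
  refine (meas_ge_le_variance_div_sq (memLp_finsetSum _ fun i _ => hL i)
    (mul_pos hn' hη)).trans (ENNReal.ofReal_le_ofReal ?_)
  rw [div_le_iff₀ (by positivity)]
  refine hvar.trans_eq ?_
  field_simp

/-! ### Time reversal and the backward limit. -/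

namespace DiscountedMDP

variable {S A : Type*} [MeasurableSpace S] (M : DiscountedMDP S A) [Fintype A] [Nonempty A]

/-- Empirical value iteration with the samples applied in reverse order: the composition
`T₀ ∘ T₁ ∘ ⋯ ∘ T_{k-1}` of the empirical Bellman operators, where `T_j` uses the samples `z j`. -/
noncomputable def backwardIterate {n : ℕ} (z : ℕ → Fin n → unitInterval) :
    ℕ → (S → ℝ) → S → ℝ
  | 0, v => v
  | k + 1, v => backwardIterate z k (M.empiricalBellman (z k) v)

/-- The intermediate `m` is the induction handle: each forward step consumes the innermost operator
remaining in the backward composition. -/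
theorem backwardIterate_empiricalIterate {n : ℕ} (z z' : ℕ → Fin n → unitInterval) {k : ℕ}
    (h : ∀ j < k, z' j = z (k - 1 - j)) {m : ℕ} (hm : m ≤ k) :
    M.backwardIterate z (k - m) (M.empiricalIterate z' m) = M.backwardIterate z k 0 := by
  induction m with
  | zero => rfl
  | succ m ih =>
    rw [← ih (by omega), empiricalIterate, h m (by omega)]
    obtain ⟨d, rfl⟩ : ∃ d, k = m + 1 + d := ⟨k - (m + 1), by omega⟩
    rw [show m + 1 + d - m = d + 1 by omega, show m + 1 + d - (m + 1) = d by omega,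
      show m + 1 + d - 1 - m = d by omega, backwardIterate]

/-- The permutation of `ℕ` that reverses the order of the first `k` numbers. -/
def reverseBelow (k j : ℕ) : ℕ := if j < k then k - 1 - j else j

theorem injective_reverseBelow (k : ℕ) : Function.Injective (reverseBelow k) := by
  intro i j h
  simp only [reverseBelow] at h
  split_ifs at h <;> omega

theorem empiricalIterate_reverseBelow {n : ℕ} (z : ℕ → Fin n → unitInterval) (k : ℕ) :
    M.empiricalIterate (fun j => z (reverseBelow k j)) k = M.backwardIterate z k 0 := by
  rw [← M.backwardIterate_empiricalIterate z (fun j => z (reverseBelow k j))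
    (fun j hj => by simp [reverseBelow, hj]) le_rfl, Nat.sub_self, backwardIterate]

variable [Fintype S]

theorem dist_backwardIterate_le {n : ℕ} (z : ℕ → Fin n → unitInterval) (k : ℕ) (v w : S → ℝ) :
    dist (M.backwardIterate z k v) (M.backwardIterate z k w) ≤ M.discount ^ k * dist v w := by
  induction k generalizing v w with
  | zero => simp [backwardIterate]
  | succ k ih =>
    refine (ih _ _).trans ?_
    rw [pow_succ, mul_assoc]
    exact mul_le_mul_of_nonneg_left (M.dist_empiricalBellman_le _ v w)
      (pow_nonneg M.discount_pos.le k)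

/-- Both iterates apply the same `k` contractions, to 0 and to `T_k 0`. -/
theorem dist_backwardIterate_succ_le {n : ℕ} (z : ℕ → Fin n → unitInterval) (k : ℕ) :
    dist (M.backwardIterate z k 0) (M.backwardIterate z (k + 1) 0)
      ≤ ‖M.cost‖ * M.discount ^ k := by
  refine (M.dist_backwardIterate_le z k _ _).trans ?_
  rw [dist_zero_left, mul_comm]
  exact mul_le_mul_of_nonneg_right (M.norm_empiricalBellman_zero_le _)
    (pow_nonneg M.discount_pos.le k)

theorem exists_tendsto_backwardIterate {n : ℕ} (z : ℕ → Fin n → unitInterval) :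
    ∃ v, Tendsto (fun k => M.backwardIterate z k 0) atTop (𝓝 v) :=
  cauchySeq_tendsto_of_complete <|
    cauchySeq_of_le_geometric _ _ M.discount_lt_one (M.dist_backwardIterate_succ_le z)

/-- The limit of empirical value iteration with the samples applied in reverse order. -/
noncomputable def backwardLimit {n : ℕ} (z : ℕ → Fin n → unitInterval) : S → ℝ :=
  (M.exists_tendsto_backwardIterate z).choose

theorem tendsto_backwardLimit {n : ℕ} (z : ℕ → Fin n → unitInterval) :
    Tendsto (fun k => M.backwardIterate z k 0) atTop (𝓝 (M.backwardLimit z)) :=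
  (M.exists_tendsto_backwardIterate z).choose_spec

theorem backwardLimit_mem_valueSpace {n : ℕ} (z : ℕ → Fin n → unitInterval) :
    M.backwardLimit z ∈ M.valueSpace :=
  M.isClosed_valueSpace.mem_of_tendsto (M.tendsto_backwardLimit z) <| .of_forall fun k => by
    rw [← empiricalIterate_reverseBelow]
    exact M.empiricalIterate_mem_valueSpace _ k

theorem dist_backwardIterate_self_le {n : ℕ} (z : ℕ → Fin n → unitInterval) {v : S → ℝ} {η : ℝ}
    {k : ℕ} (h : ∀ j < k, dist (M.empiricalBellman (z j) v) v ≤ η) :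
    dist (M.backwardIterate z k v) v ≤ η * ∑ j ∈ Finset.range k, M.discount ^ j := by
  induction k with
  | zero => simp [backwardIterate]
  | succ k ih =>
    refine (dist_triangle _ (M.backwardIterate z k v) _).trans ?_
    rw [Finset.sum_range_succ, mul_add, add_comm]
    refine add_le_add (ih fun j hj => h j (by omega)) ?_
    refine (M.dist_backwardIterate_le z k _ _).trans ?_
    rw [mul_comm]
    exact mul_le_mul_of_nonneg_right (h k k.lt_succ_self) (pow_nonneg M.discount_pos.le k)

theorem dist_backwardLimit_le {n : ℕ} (z : ℕ → Fin n → unitInterval) {v : S → ℝ} {η : ℝ}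
    (hη : 0 ≤ η) {k : ℕ} (h : ∀ j < k, dist (M.empiricalBellman (z j) v) v ≤ η) :
    dist (M.backwardLimit z) v ≤
      M.discount ^ k * (‖M.cost‖ / (1 - M.discount) + ‖v‖) + η / (1 - M.discount) := by
  have h1 := dist_le_of_le_geometric_of_tendsto _ _ M.discount_lt_one
    (M.dist_backwardIterate_succ_le z) (M.tendsto_backwardLimit z) k
  have h2 := M.dist_backwardIterate_le z k 0 v
  have h3 := M.dist_backwardIterate_self_le z h
  have h4 : η * ∑ j ∈ Finset.range k, M.discount ^ j ≤ η / (1 - M.discount) := by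
    rw [div_eq_mul_inv, ← tsum_geometric_of_lt_one M.discount_pos.le M.discount_lt_one]
    refine mul_le_mul_of_nonneg_left ?_ hη
    exact (summable_geometric_of_lt_one M.discount_pos.le M.discount_lt_one).sum_le_tsum _
      fun j _ => pow_nonneg M.discount_pos.le j
  have h5 := dist_triangle4 (M.backwardLimit z) (M.backwardIterate z k 0)
    (M.backwardIterate z k v) v
  rw [dist_comm] at h1
  rw [dist_zero_left] at h2
  have h6 : M.discount ^ k * (‖M.cost‖ / (1 - M.discount) + ‖v‖) =
      ‖M.cost‖ * M.discount ^ k / (1 - M.discount) + M.discount ^ k * ‖v‖ := by ring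
  linarith

variable [DiscreteMeasurableSpace S]

theorem measurable_empiricalIterate (n k : ℕ) :
    Measurable fun z : ℕ × Fin n → unitInterval =>
      M.empiricalIterate (fun j i => z (j, i)) k := by
  induction k with
  | zero => exact measurable_const
  | succ k ih =>
    refine measurable_pi_lambda _ fun s => ?_
    have h (a : A) : Measurable fun z : ℕ × Fin n → unitInterval => M.cost s a +
        M.discount / n * ∑ i, M.empiricalIterate (fun j i => z (j, i)) k
          (M.next s a (z (k, i))) := by
      refine measurable_const.add (measurable_const.mul ?_)
      refine Finset.measurable_fun_sum _ fun i _ => ?_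
      -- The iterate is evaluated at a random state; joint measurability holds because `S` is
      -- countable.
      have he : Measurable fun p : (S → ℝ) × S => p.1 p.2 :=
        measurable_from_prod_countable_left fun x => measurable_pi_apply x
      exact he.comp (ih.prodMk ((M.measurable_next s a).comp (measurable_pi_apply (k, i))))
    convert Finset.inf'_induction (Finset.univ_nonempty (α := A)) _ (p := Measurable)
      (fun _ h₁ _ h₂ => h₁.inf h₂) fun a _ => h a using 1
    ext z
    simp [empiricalIterate, empiricalBellman, Finset.inf'_apply]

/-! ### Laws of the iterates and concentration in `n`. -/

section Samples

variable {Ω : Type*} [MeasurableSpace Ω] {P : Measure Ω} {n : ℕ} {Z : ℕ → Fin n → Ω → unitInterval}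

theorem identDistrib_backwardIterate (hm : ∀ k i, Measurable (Z k i))
    (hl : ∀ k i, P.map (Z k i) = volume)
    (hi : iIndepFun (fun p : ℕ × Fin n => Z p.1 p.2) P) (k : ℕ) :
    IdentDistrib (fun ω => M.backwardIterate (fun j i => Z j i ω) k 0)
      (fun ω => M.empiricalIterate (fun j i => Z j i ω) k) P P := by
  have hinj : Function.Injective fun p : ℕ × Fin n => (reverseBelow k p.1, p.2) := by
    rintro ⟨a, b⟩ ⟨c, d⟩ h
    rw [Prod.mk.injEq] at h
    exact Prod.ext (injective_reverseBelow k h.1) h.2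
  have h := IdentDistrib.pi
    (X := fun (p : ℕ × Fin n) => Z (reverseBelow k p.1) p.2)
    (Y := fun (p : ℕ × Fin n) => Z p.1 p.2) (μ := P) (ν := P)
    (fun p => ⟨(hm _ _).aemeasurable, (hm _ _).aemeasurable, by rw [hl, hl]⟩)
    (hi.precomp hinj) hi
  have h' := h.comp (M.measurable_empiricalIterate n k)
  simp_rw [← empiricalIterate_reverseBelow]
  exact h'

theorem measurable_backwardLimit (hm : ∀ k i, Measurable (Z k i)) :
    Measurable fun ω => M.backwardLimit fun j i => Z j i ω := by
  refine measurable_of_tendsto_metrizable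
    (f := fun k ω => M.backwardIterate (fun j i => Z j i ω) k 0) (fun k => ?_)
    (tendsto_pi_nhds.2 fun ω => M.tendsto_backwardLimit _)
  simp_rw [← empiricalIterate_reverseBelow]
  have h : Measurable fun ω (p : ℕ × Fin n) => Z (reverseBelow k p.1) p.2 ω :=
    measurable_pi_lambda _ fun p => hm _ _
  exact (M.measurable_empiricalIterate n k).comp h

theorem tendstoInDistribution_empiricalIterate [IsProbabilityMeasure P]
    (hm : ∀ k i, Measurable (Z k i))
    (hl : ∀ k i, P.map (Z k i) = volume)
    (hi : iIndepFun (fun p : ℕ × Fin n => Z p.1 p.2) P) :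
    TendstoInDistribution (fun (k : ℕ) (ω : Ω) => M.empiricalIterate (fun j i => Z j i ω) k)
      atTop (fun ω => M.backwardLimit fun j i => Z j i ω) (fun _ => P) P := by
  have hid := M.identDistrib_backwardIterate hm hl hi
  have h := tendstoInDistribution_of_ae_tendsto (μ' := P) (l := atTop)
    (fun k => (hid k).aemeasurable_fst) (M.measurable_backwardLimit hm).aemeasurable
    (.of_forall fun ω => M.tendsto_backwardLimit _)
  refine ⟨fun k => (hid k).aemeasurable_snd, h.aemeasurable_limit, ?_⟩
  refine h.tendsto.congr fun k => Subtype.ext ?_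
  exact (hid k).map_eq

theorem measure_lt_dist_empiricalBellman_le [IsProbabilityMeasure P] (hn : 0 < n)
    {z : Fin n → Ω → unitInterval} (hm : ∀ i, Measurable (z i)) (hl : ∀ i, P.map (z i) = volume) (hi : iIndepFun z P)
    (v : S → ℝ) {η : ℝ} (hη : 0 < η) :
    P {ω | η < dist (M.empiricalBellman (fun i => z i ω) v) (M.bellman v)} ≤
      ∑ _s : S, ∑ _a : A, ENNReal.ofReal (‖v‖ ^ 2 / η ^ 2 / n) := by
  have hsub : {ω | η < dist (M.empiricalBellman (fun i => z i ω) v) (M.bellman v)} ⊆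
      ⋃ s : S, ⋃ a : A, {ω | η ≤ |(∑ i, v (M.next s a (z i ω))) / n -
        ∫ u, v (M.next s a u)|} := by
    intro ω hω
    by_contra hcon
    simp only [Set.mem_iUnion, Set.mem_ofPred_eq, not_exists, not_le] at hcon hω
    refine hω.not_ge ((dist_pi_le_iff hη.le).2 fun s => ?_)
    rw [Real.dist_eq]
    refine Finset.abs_inf'_sub_inf'_le _ fun a _ => ?_
    have hα := M.discount_pos
    rw [add_sub_add_left_eq_sub, div_mul_eq_mul_div, mul_div_assoc, ← mul_sub, abs_mul,
      abs_of_pos hα]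
    calc _ ≤ 1 * η := mul_le_mul M.discount_lt_one.le (hcon s a).le (abs_nonneg _) zero_le_one
      _ = η := one_mul η
  refine (measure_mono hsub).trans ((measure_iUnion_fintype_le _ _).trans ?_)
  refine Finset.sum_le_sum fun s _ => (measure_iUnion_fintype_le _ _).trans ?_
  refine Finset.sum_le_sum fun a _ => ?_
  exact measure_le_abs_average_sub_integral_le hn hm hl hi
    ((measurable_of_finite v).comp (M.measurable_next s a)) (fun u => norm_le_pi_norm v _) hη

end Samples

theorem tendstoInMeasure_backwardLimit {Ω : Type*} [MeasurableSpace Ω] {P : Measure Ω}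
    [IsProbabilityMeasure P] {Z : (n : ℕ) → ℕ → Fin n → Ω → unitInterval}
    (hm : ∀ n k i, Measurable (Z n k i)) (hl : ∀ n k i, P.map (Z n k i) = volume)
    (hi : ∀ n, iIndepFun (fun p : ℕ × Fin n => Z n p.1 p.2) P) {v : S → ℝ}
    (hv : M.bellman v = v) :
    TendstoInMeasure P (fun n ω => M.backwardLimit fun j i => Z n j i ω) atTop (fun _ => v) := by
  rw [tendstoInMeasure_iff_dist]
  intro ε hε
  have hα := M.one_sub_discount_pos
  set K := ‖M.cost‖ / (1 - M.discount) + ‖v‖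
  -- The depth `k` is chosen before `n`, so the union bound below has a number of terms independent
  -- of `n`.
  obtain ⟨k, hk⟩ : ∃ k : ℕ, M.discount ^ k * K < ε / 2 := by
    have h := (tendsto_pow_atTop_nhds_zero_of_lt_one M.discount_pos.le
      M.discount_lt_one).mul_const K
    rw [zero_mul] at h
    exact (h.eventually_lt_const (half_pos hε)).exists
  -- Chosen so that the accumulated error `η / (1 - α)` is the other half of `ε`.
  set η := (1 - M.discount) * (ε / 2)
  have hη : 0 < η := mul_pos hα (half_pos hε)
  have hbound : ∀ᶠ n : ℕ in atTop,
      P {ω | ε ≤ dist (M.backwardLimit fun j i => Z n j i ω) v} ≤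
        ∑ _j ∈ Finset.range k, ∑ _s : S, ∑ _a : A,
          ENNReal.ofReal (‖v‖ ^ 2 / η ^ 2 / n) := by
    filter_upwards [eventually_gt_atTop 0] with n hn
    have hsub : {ω | ε ≤ dist (M.backwardLimit fun j i => Z n j i ω) v} ⊆
        ⋃ j ∈ Finset.range k,
          {ω | η < dist (M.empiricalBellman (fun i => Z n j i ω) v) (M.bellman v)} := by
      intro ω hω
      by_contra hcon
      simp only [Set.mem_iUnion, Set.mem_ofPred_eq, not_exists, not_lt, hv,
        Finset.mem_range] at hcon hω
      have h := M.dist_backwardLimit_le _ hη.le hcon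
      have : η / (1 - M.discount) = ε / 2 := mul_div_cancel_left₀ _ hα.ne'
      linarith
    refine (measure_mono hsub).trans ((measure_biUnion_finset_le _ _).trans ?_)
    refine Finset.sum_le_sum fun j _ => ?_
    refine M.measure_lt_dist_empiricalBellman_le hn (hm n j) (hl n j) ?_ v hη
    exact (hi n).precomp (g := fun i => (j, i)) fun i i' h => (Prod.mk.inj h).2
  refine tendsto_of_tendsto_of_tendsto_of_le_of_le' tendsto_const_nhds ?_
    (.of_forall fun _ => zero_le) hbound
  have h0 : Tendsto (fun n : ℕ => ENNReal.ofReal (‖v‖ ^ 2 / η ^ 2 / n)) atTop (𝓝 0) := by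
    simpa using ENNReal.tendsto_ofReal (tendsto_const_div_atTop_nhds_zero_nat (‖v‖ ^ 2 / η ^ 2))
  simpa using tendsto_finsetSum (Finset.range k) fun _ _ =>
    tendsto_finsetSum (Finset.univ : Finset S) fun _ _ =>
      tendsto_finsetSum (Finset.univ : Finset A) fun _ _ => h0

end DiscountedMDP

theorem mainTheorem3 {S A Ω : Type*} [Fintype S] [MeasurableSpace S] [DiscreteMeasurableSpace S]
    [Fintype A] [Nonempty A] (M : DiscountedMDP S A)
    [MeasurableSpace Ω] (P : Measure Ω) [IsProbabilityMeasure P]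
    (Z : (n : ℕ) → ℕ → Fin n → Ω → unitInterval)
    (hZ_meas : ∀ n k i, Measurable (Z n k i))
    (hZ_law : ∀ n k i, P.map (Z n k i) = volume)
    (hZ_indep : ∀ n, iIndepFun (fun p : ℕ × Fin n => Z n p.1 p.2) P) :
    M.bellman M.optimalValue = M.optimalValue ∧
    ∃ vInf : ℕ → Ω → S → ℝ,
      (∀ n, 1 ≤ n →
        (∀ ω, vInf n ω ∈ M.valueSpace) ∧
        TendstoInDistribution
          (fun (k : ℕ) (ω : Ω) => M.empiricalIterate (fun j i => Z n j i ω) k)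
          atTop (vInf n) (fun _ => P) P) ∧
      TendstoInMeasure P vInf atTop (fun _ => M.optimalValue) :=
  ⟨M.bellman_optimalValue, fun n ω => M.backwardLimit fun j i => Z n j i ω,
    fun n _ => ⟨fun _ => M.backwardLimit_mem_valueSpace _,
      M.tendstoInDistribution_empiricalIterate (hZ_meas n) (hZ_law n) (hZ_indep n)⟩,
    M.tendstoInMeasure_backwardLimit hZ_meas hZ_law hZ_indep M.bellman_optimalValue⟩
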